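/- Let $\mathbb{D}=\{z\in\mathbb{C}: |z|<1\}$ and let $A(\mathbb{D})$ be the disk algebra, i.e. the algebra of continuous functions on $\overline{\mathbb{D}}$ that are holomorphic on $\mathbb{D}$, with the supremum norm. A bounded linear operator $G$ on a complex Banach space $X$ is called a Daugavet center if $\|G+T\|=\|G\|+\|T\|$ for every bounded linear rank-$1$ operator $T:X\to X$. A function $f$ is called inner if it is holomorphic on $\mathbb{D}$ with $|f|\le 1$ there, and for almost every $\theta\in\mathbb{R}$ the radial limit $\lim_{r\to1^-}f(re^{i\theta})$ exists and has modulus $1$. Let $\varphi,u\in A(\mathbb{D})$ with $\varphi(\mathbb{D})\subset\mathbb{D}$ and $u\neq 0$, and let $uC_\varphi:A(\mathbb{D})\to A(\mathbb{D})$ be the weighted composition operator $f\mapsto u\cdot(f\circ\varphi)$. Then $uC_\varphi$ is a Daugavet center if and only if $\varphi$ is an inner function and $u$ is a constant multiple of an inner function. -/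

import Mathlib

open Metric Filter Topology Set

/-- A function on the closed unit disk, viewed as a function on `ℂ` (with the value `0` off the
closed unit disk). -/
noncomputable def closedDiskExtend (f : C(closedBall (0 : ℂ) 1, ℂ)) : ℂ → ℂ :=
  Function.extend Subtype.val f 0

theorem closedDiskExtend_apply (f : C(closedBall (0 : ℂ) 1, ℂ)) {z : ℂ}
    (hz : z ∈ closedBall (0 : ℂ) 1) : closedDiskExtend f z = f ⟨z, hz⟩ :=
  Subtype.val_injective.extend_apply f 0 ⟨z, hz⟩

/-- The algebra of continuous functions on the closed unit disk which are holomorphic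
on the open unit disk. It carries the supremum norm of `C(closedBall 0 1, ℂ)`. -/
noncomputable def diskSubalgebra : Subalgebra ℂ C(closedBall (0 : ℂ) 1, ℂ) where
  carrier := {f | DifferentiableOn ℂ (closedDiskExtend f) (ball 0 1)}
  mul_mem' := by
    intro f g hf hg
    refine (DifferentiableOn.mul hf hg).congr fun z hz => ?_
    simp [closedDiskExtend_apply _ (ball_subset_closedBall hz)]
  add_mem' := by
    intro f g hf hg
    refine (DifferentiableOn.add hf hg).congr fun z hz => ?_
    simp [closedDiskExtend_apply _ (ball_subset_closedBall hz)]
  algebraMap_mem' := by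
    intro c
    refine (differentiableOn_const c).congr fun z hz => ?_
    simp [closedDiskExtend_apply _ (ball_subset_closedBall hz)]

/-- The disk algebra `A(𝔻)` as a normed space. -/
abbrev DiskAlgebra : Type := diskSubalgebra

namespace DiskAlgebra

/-- The function underlying an element of the disk algebra, as a function on `ℂ` (with the value
`0` off the closed unit disk). -/
noncomputable def toFun (f : DiskAlgebra) : ℂ → ℂ :=
  closedDiskExtend f.1

theorem toFun_apply (f : DiskAlgebra) {z : ℂ} (hz : z ∈ closedBall (0 : ℂ) 1) :
    f.toFun z = f.1 ⟨z, hz⟩ :=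
  closedDiskExtend_apply f.1 hz

theorem differentiableOn_toFun (f : DiskAlgebra) : DifferentiableOn ℂ f.toFun (ball 0 1) :=
  f.2

theorem continuousOn_toFun (f : DiskAlgebra) : ContinuousOn f.toFun (closedBall 0 1) := by
  rw [continuousOn_iff_continuous_domRestrict]
  have h : (closedBall (0 : ℂ) 1).domRestrict f.toFun = f.1 := by
    ext z
    exact f.toFun_apply z.2
  rw [h]
  exact f.1.continuous

/-- The norm of `A(𝔻)` is the supremum of the modulus over the open unit disk. -/
theorem isLUB_norm (f : DiskAlgebra) :
    IsLUB ((fun z => ‖f.toFun z‖) '' ball (0 : ℂ) 1) ‖f‖ := by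
  refine ⟨?_, fun M hM => ?_⟩
  · rintro _ ⟨z, hz, rfl⟩
    have hz' := ball_subset_closedBall hz
    simp only [f.toFun_apply hz']
    exact f.1.norm_coe_le_norm ⟨z, hz'⟩
  · have h0 : (0 : ℝ) ≤ M :=
      (norm_nonneg _).trans (hM ⟨0, mem_ball_self one_pos, rfl⟩)
    refine (ContinuousMap.norm_le f.1 h0).2 fun z => ?_
    rw [← f.toFun_apply z.2]
    have hz : (z : ℂ) ∈ closure (ball (0 : ℂ) 1) := by
      rw [closure_ball _ one_ne_zero]; exact z.2
    have hc : ContinuousOn (fun z => ‖f.toFun z‖) (closure (ball (0 : ℂ) 1)) := by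
      rw [closure_ball _ one_ne_zero]; exact f.continuousOn_toFun.norm
    exact le_on_closure (fun w hw => hM ⟨w, hw, rfl⟩) hc continuousOn_const hz

theorem mapsTo_closedBall {φ : DiskAlgebra}
    (hφ : MapsTo φ.toFun (ball 0 1) (ball 0 1)) :
    MapsTo φ.toFun (closedBall 0 1) (closedBall 0 1) := by
  have hc : ContinuousOn φ.toFun (closure (ball 0 1)) := by
    rw [closure_ball _ one_ne_zero]; exact φ.continuousOn_toFun
  have h := hφ.closure_of_continuousOn hc
  rwa [closure_ball _ one_ne_zero] at h

/-- The function `u · (f ∘ φ)` as an element of the disk algebra. -/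
noncomputable def weightedComp (u φ : DiskAlgebra)
    (hφ : MapsTo φ.toFun (ball 0 1) (ball 0 1)) (f : DiskAlgebra) : DiskAlgebra :=
  ⟨⟨fun z => u.toFun z * f.toFun (φ.toFun z), by
      have h : ContinuousOn (fun z => u.toFun z * f.toFun (φ.toFun z)) (closedBall 0 1) :=
        u.continuousOn_toFun.mul
          (f.continuousOn_toFun.comp φ.continuousOn_toFun (mapsTo_closedBall hφ))
      exact continuousOn_iff_continuous_domRestrict.1 h⟩, by
    have h : DifferentiableOn ℂ (fun z => u.toFun z * f.toFun (φ.toFun z)) (ball 0 1) :=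
      u.differentiableOn_toFun.mul
        (f.differentiableOn_toFun.comp φ.differentiableOn_toFun hφ)
    exact h.congr fun z hz => closedDiskExtend_apply _ (ball_subset_closedBall hz)⟩

/-- The weighted composition operator `uC_φ : f ↦ u · (f ∘ φ)` on the disk algebra. -/
noncomputable def weightedCompOp (u φ : DiskAlgebra)
    (hφ : MapsTo φ.toFun (ball 0 1) (ball 0 1)) : DiskAlgebra →L[ℂ] DiskAlgebra :=
  LinearMap.mkContinuous
    { toFun := weightedComp u φ hφ
      map_add' := fun f g => by
        ext z
        have hz := mapsTo_closedBall hφ z.2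
        change u.toFun z * (f + g).toFun (φ.toFun z) =
          u.toFun z * f.toFun (φ.toFun z) + u.toFun z * g.toFun (φ.toFun z)
        rw [toFun_apply _ hz, toFun_apply _ hz, toFun_apply _ hz]
        exact mul_add _ _ _
      map_smul' := fun c f => by
        ext z
        have hz := mapsTo_closedBall hφ z.2
        change u.toFun z * (c • f).toFun (φ.toFun z) = c * (u.toFun z * f.toFun (φ.toFun z))
        rw [toFun_apply _ hz, toFun_apply _ hz]
        exact mul_left_comm _ _ _ }
    ‖u‖ fun f => by
      refine (ContinuousMap.norm_le _ (by positivity)).2 fun z => ?_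
      have hz := mapsTo_closedBall hφ z.2
      change ‖u.toFun z * f.toFun (φ.toFun z)‖ ≤ _
      rw [norm_mul, u.toFun_apply z.2, f.toFun_apply hz]
      exact mul_le_mul (u.1.norm_coe_le_norm _) (f.1.norm_coe_le_norm _)
        (norm_nonneg _) (norm_nonneg _)

theorem weightedCompOp_toFun (u φ : DiskAlgebra)
    (hφ : MapsTo φ.toFun (ball 0 1) (ball 0 1)) (f : DiskAlgebra) {z : ℂ}
    (hz : z ∈ closedBall (0 : ℂ) 1) :
    (weightedCompOp u φ hφ f).toFun z = u.toFun z * f.toFun (φ.toFun z) :=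
  toFun_apply _ hz

end DiskAlgebra

/-- `G` is a Daugavet center: `‖G + T‖ = ‖G‖ + ‖T‖` for every rank-one bounded operator `T`. -/
def IsDaugavetCenter {X : Type*} [NormedAddCommGroup X] [NormedSpace ℂ X] (G : X →L[ℂ] X) : Prop :=
  ∀ T : X →L[ℂ] X, Module.finrank ℂ (LinearMap.range (T : X →ₗ[ℂ] X)) = 1 →
    ‖G + T‖ = ‖G‖ + ‖T‖

/-- `f` is an inner function: it is holomorphic and bounded by one on the open unit disk, and its
radial limits exist and are unimodular at almost every point of the unit circle. Only the values of
`f` on the open unit disk matter. -/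
structure IsInnerFunction (f : ℂ → ℂ) : Prop where
  differentiableOn : DifferentiableOn ℂ f (ball 0 1)
  norm_le_one : ∀ z ∈ ball (0 : ℂ) 1, ‖f z‖ ≤ 1
  radial_limit : ∀ᵐ θ : ℝ, ∃ l : ℂ, ‖l‖ = 1 ∧
    Tendsto (fun r : ℝ => f (r * Complex.exp (θ * Complex.I))) (𝓝[<] 1) (𝓝 l)

/-!
For `φ, u` continuous up to the boundary, being inner (up to a constant factor in the case of `u`) is
a pointwise condition on the unit circle: `‖φ‖ = 1` and `‖u‖` constant there
(`ContinuousOn.norm_eq_of_ae_radial`, `IsInnerFunction.of_norm_eq_one`). It has to be shown that this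
is equivalent to the Daugavet equation `‖G + T‖ = ‖G‖ + ‖T‖` for all `T` of rank one, `G = uC_φ`.

*Necessity.* Suppose the condition fails at a boundary point `w`. If there is a functional `x ≠ 0`
such that `‖u(z) f(φ(z))‖ + ‖x f‖` stays below a constant less than `‖u‖ + ‖x‖` for `z` near `w` and
`f` in the unit ball, then `T = x ⊗ g`, with `g` peaking at `w`, violates the equation
(`not_isDaugavetCenter_of_functional`). If `‖u(w)‖ < ‖u‖`, every `x ≠ 0` has this property. If
`a = φ(w)` lies in the open disk, one takes `x f = f(b) - f(a)` with `b` near `a`: by the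
Borel–Carathéodory inequality, a function in the unit ball whose modulus is almost one near `a` is
almost constant there (`norm_sub_le_of_norm_le_one`).

*Sufficiency.* Let `f₀` in the unit ball almost norm `T`, and let `T f₀` attain its norm at the
boundary point `z₀`. For `z` near `z₀` on the circle and `k` a function that equals one at `φ(z)`, is
small away from that point, and takes values close to the segment `[0, 1]` (`exists_bump_at_one`), the
function `f = f₀ + (l - f₀(φ(z))) k` has norm close to one and takes the value `l` at `φ(z)`. If `T k` is
small, a suitable unimodular `l` makes `‖(G + T) f‖` almost `‖u‖ + ‖T‖` at `z`
(`isDaugavetCenter_of_norm_eq`). In order that `T k` be small, `k` is picked among many almost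
disjoint bumps: norms add up on the one-dimensional range of `T`, while unimodular combinations of
the bumps are bounded by `3` (`exists_isBump_norm_map_le`). There are enough points `φ(z)` for this,
because `φ` takes infinitely many values on every arc (`infinite_image_of_norm_eq_one`).

The analysis uses the disk algebra only through the functions its elements represent, and is carried
out for any normed space realizing it (`IsDiskAlgebra`).
-/

/-! ### Isometric realizations of the disk algebra -/

/-- `ev` realizes the normed space `X` as the disk algebra: `ev f` is the function represented by
`f`, extended by zero off the closed disk; it is continuous on the closed disk and holomorphic inside,
every such function occurs, and the norm is the supremum over the open disk. -/
structure IsDiskAlgebra {X : Type*} [NormedAddCommGroup X] [NormedSpace ℂ X]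
    (ev : X →ₗ[ℂ] ℂ → ℂ) : Prop where
  eq_zero : ∀ f, ∀ z ∉ closedBall (0 : ℂ) 1, ev f z = 0
  continuousOn : ∀ f, ContinuousOn (ev f) (closedBall 0 1)
  differentiableOn : ∀ f, DifferentiableOn ℂ (ev f) (ball 0 1)
  isLUB_norm : ∀ f, IsLUB ((fun z => ‖ev f z‖) '' ball (0 : ℂ) 1) ‖f‖
  exists_eqOn : ∀ F : ℂ → ℂ, ContinuousOn F (closedBall 0 1) → DifferentiableOn ℂ F (ball 0 1) →
    ∃ f, EqOn (ev f) F (closedBall 0 1)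

namespace IsDiskAlgebra

variable {X : Type*} [NormedAddCommGroup X] [NormedSpace ℂ X] {ev : X →ₗ[ℂ] ℂ → ℂ}

theorem diffContOnCl (h : IsDiskAlgebra ev) (f : X) : DiffContOnCl ℂ (ev f) (ball 0 1) :=
  ⟨h.differentiableOn f, by rw [closure_ball _ one_ne_zero]; exact h.continuousOn f⟩

theorem norm_apply_le (h : IsDiskAlgebra ev) (f : X) (z : ℂ) : ‖ev f z‖ ≤ ‖f‖ := by
  by_cases hz : z ∈ closedBall (0 : ℂ) 1
  · refine le_on_closure (s := ball (0 : ℂ) 1) (f := fun z => ‖ev f z‖)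
      (fun w hw => (h.isLUB_norm f).1 ⟨w, hw, rfl⟩) (h.diffContOnCl f).continuousOn.norm
      continuousOn_const ?_
    rwa [closure_ball _ one_ne_zero]
  · rw [h.eq_zero f z hz, norm_zero]
    exact norm_nonneg f

/-- Evaluation at a point of `ℂ` as a bounded functional (the zero functional at points off the
closed disk). -/
noncomputable def eval (h : IsDiskAlgebra ev) (z : ℂ) : X →L[ℂ] ℂ :=
  (LinearMap.proj z ∘ₗ ev).mkContinuous 1 fun f => by simpa using h.norm_apply_le f z

theorem eval_apply (h : IsDiskAlgebra ev) (z : ℂ) (f : X) : h.eval z f = ev f z := rfl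

theorem norm_le_of_sphere (h : IsDiskAlgebra ev) (f : X) {C : ℝ}
    (hC : ∀ z ∈ sphere (0 : ℂ) 1, ‖ev f z‖ ≤ C) : ‖f‖ ≤ C := by
  refine (h.isLUB_norm f).2 ?_
  rintro _ ⟨z, hz, rfl⟩
  refine Complex.norm_le_of_forall_mem_frontier_norm_le isBounded_ball (h.diffContOnCl f) ?_
    (subset_closure hz)
  rwa [frontier_ball _ one_ne_zero]

theorem exists_mem_sphere_norm_eq (h : IsDiskAlgebra ev) (f : X) :
    ∃ z ∈ sphere (0 : ℂ) 1, ‖ev f z‖ = ‖f‖ := by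
  obtain ⟨z, hz, hmax⟩ := (isCompact_sphere (0 : ℂ) 1).exists_isMaxOn
    (NormedSpace.sphere_nonempty.2 zero_le_one)
    ((h.continuousOn f).mono sphere_subset_closedBall).norm
  exact ⟨z, hz, (h.norm_apply_le f z).antisymm (h.norm_le_of_sphere f fun w hw => hmax hw)⟩

theorem norm_eq_of_sphere (h : IsDiskAlgebra ev) (f : X) {C : ℝ}
    (hC : ∀ z ∈ sphere (0 : ℂ) 1, ‖ev f z‖ = C) : ‖f‖ = C := by
  obtain ⟨z, hz, hzf⟩ := h.exists_mem_sphere_norm_eq f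
  rw [← hzf, hC z hz]

theorem continuousWithinAt_sphere (h : IsDiskAlgebra ev) (f : X) {z : ℂ}
    (hz : z ∈ sphere (0 : ℂ) 1) : ContinuousWithinAt (ev f) (sphere 0 1) z :=
  ((h.continuousOn f).mono sphere_subset_closedBall) z hz

theorem exists_eqOn_one (h : IsDiskAlgebra ev) :
    ∃ e : X, ‖e‖ = 1 ∧ ∀ z ∈ closedBall (0 : ℂ) 1, ev e z = 1 := by
  obtain ⟨e, he⟩ := h.exists_eqOn 1 continuousOn_const (differentiableOn_const 1)
  refine ⟨e, h.norm_eq_of_sphere e fun z hz => ?_, he⟩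
  simp [he (sphere_subset_closedBall hz)]

theorem exists_eqOn_id (h : IsDiskAlgebra ev) :
    ∃ e : X, ∀ z ∈ closedBall (0 : ℂ) 1, ev e z = z :=
  h.exists_eqOn id continuousOn_id differentiableOn_id

/-! ### Weighted composition operators -/

/-- `G` is the weighted composition operator `f ↦ u · (f ∘ φ)`, where `φ` maps the open disk into
itself. -/
structure IsWeightedComp (ev : X →ₗ[ℂ] ℂ → ℂ) (u φ : X) (G : X →L[ℂ] X) : Prop where
  mapsTo : MapsTo (ev φ) (ball 0 1) (ball 0 1)
  apply_eq : ∀ f, ∀ z ∈ closedBall (0 : ℂ) 1, ev (G f) z = ev u z * ev f (ev φ z)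

theorem mapsTo_closedBall (h : IsDiskAlgebra ev) {φ : X}
    (hφ : MapsTo (ev φ) (ball 0 1) (ball 0 1)) :
    MapsTo (ev φ) (closedBall 0 1) (closedBall 0 1) := by
  have := hφ.closure_of_continuousOn (h.diffContOnCl φ).continuousOn
  rwa [closure_ball _ one_ne_zero] at this

theorem norm_weightedComp (h : IsDiskAlgebra ev) {u φ : X} {G : X →L[ℂ] X}
    (hG : IsWeightedComp ev u φ G) : ‖G‖ = ‖u‖ := by
  refine le_antisymm (G.opNorm_le_bound (norm_nonneg _) fun f => ?_) ?_
  · refine h.norm_le_of_sphere _ fun z hz => ?_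
    rw [hG.apply_eq f z (sphere_subset_closedBall hz), norm_mul]
    gcongr <;> exact h.norm_apply_le _ _
  · obtain ⟨z, hz, hzu⟩ := h.exists_mem_sphere_norm_eq u
    obtain ⟨e, he, he1⟩ := h.exists_eqOn_one
    have hz' := sphere_subset_closedBall hz
    have := (h.norm_apply_le (G e) z).trans (G.unit_le_opNorm e he.le)
    rwa [hG.apply_eq e z hz', he1 _ (h.mapsTo_closedBall hG.mapsTo hz'), mul_one, hzu] at this

/-! ### Necessity: rank-one test operators -/

/-- A function of norm one peaking at the boundary point `w`. -/
theorem exists_peak (h : IsDiskAlgebra ev) {w : ℂ} (hw : w ∈ sphere (0 : ℂ) 1) {V : Set ℂ}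
    (hV : V ∈ 𝓝 w) :
    ∃ g : X, ‖g‖ = 1 ∧ ∃ q < 1, ∀ z ∈ sphere (0 : ℂ) 1, z ∉ V → ‖ev g z‖ ≤ q := by
  have hd : Differentiable ℂ fun z : ℂ => (w + z) / 2 := by fun_prop
  obtain ⟨ρ, hρ, hρV⟩ := Metric.mem_nhds_iff.1 hV
  rw [mem_sphere_zero_iff_norm] at hw
  have key : ∀ z ∈ sphere (0 : ℂ) 1, ‖(w + z) / 2‖ ^ 2 = 1 - ‖w - z‖ ^ 2 / 4 := by
    intro z hz
    rw [mem_sphere_zero_iff_norm] at hz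
    have := parallelogram_law_with_norm ℝ w z
    rw [hw, hz] at this
    rw [norm_div, Complex.norm_ofNat]
    nlinarith
  obtain ⟨g, hg⟩ := h.exists_eqOn _ hd.continuous.continuousOn hd.differentiableOn
  refine ⟨g, le_antisymm ?_ ?_, √(1 - ρ ^ 2 / 4), ?_, ?_⟩
  · refine h.norm_le_of_sphere g fun z hz => ?_
    rw [hg (sphere_subset_closedBall hz)]
    refine abs_le_of_sq_le_sq' ?_ zero_le_one |>.2
    rw [key z hz]
    nlinarith [sq_nonneg ‖w - z‖]
  · have := h.norm_apply_le g w
    rw [hg (by simp [hw])] at this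
    simpa [hw] using this
  · rw [Real.sqrt_lt' one_pos]
    nlinarith [sq_pos_of_pos hρ]
  · intro z hz hzV
    rw [hg (sphere_subset_closedBall hz)]
    refine Real.le_sqrt_of_sq_le ?_
    rw [key z hz]
    have : ρ ≤ ‖w - z‖ := by
      by_contra! hlt
      exact hzV (hρV (by rwa [mem_ball', dist_eq_norm]))
    gcongr

/-- If a nonzero functional `x` is such that `‖u(z) f(φ(z))‖ + ‖x f‖` stays away from `‖u‖ + ‖x‖`
for `z` near some boundary point, uniformly in the unit ball, then `x ⊗ g` violates the Daugavet
equation for any `g` that peaks at that point. -/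
theorem not_isDaugavetCenter_of_functional (h : IsDiskAlgebra ev) {u φ : X} {G : X →L[ℂ] X}
    (hG : IsWeightedComp ev u φ G) {w : ℂ} (hw : w ∈ sphere (0 : ℂ) 1)
    {x : X →L[ℂ] ℂ} (hx : x ≠ 0) {V : Set ℂ} (hV : V ∈ 𝓝 w) {C : ℝ} (hC : C < ‖u‖ + ‖x‖)
    (hVx : ∀ z ∈ sphere (0 : ℂ) 1, z ∈ V → ∀ f : X, ‖f‖ ≤ 1 →
      ‖ev u z‖ * ‖ev f (ev φ z)‖ + ‖x f‖ ≤ C) :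
    ¬ IsDaugavetCenter G := by
  intro hD
  obtain ⟨g, hg, q, hq, hgq⟩ := h.exists_peak hw hV
  have hx' : 0 < ‖x‖ := norm_pos_iff.2 hx
  have hg0 : g ≠ 0 := by
    rintro rfl
    simp at hg
  have hT := hD (x.smulRight g) (by
    rw [ContinuousLinearMap.range_smulRight_apply hx]
    exact finrank_span_singleton hg0)
  rw [h.norm_weightedComp hG, ContinuousLinearMap.norm_smulRight_apply, hg, mul_one] at hT
  refine hT.not_lt (lt_of_le_of_lt (b := max C (‖u‖ + ‖x‖ * max q 0)) ?_ ?_)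
  · refine ContinuousLinearMap.opNorm_le_of_unit_norm (𝕜 := ℂ)
      (le_max_of_le_right (by positivity)) fun f hf => h.norm_le_of_sphere _ fun z hz => ?_
    have e : ev ((G + x.smulRight g) f) z = ev u z * ev f (ev φ z) + x f * ev g z := by
      simp [hG.apply_eq f z (sphere_subset_closedBall hz)]
    rw [e]
    refine (norm_add_le _ _).trans ?_
    rw [norm_mul, norm_mul]
    by_cases hzV : z ∈ V
    · refine le_max_of_le_left (le_trans ?_ (hVx z hz hzV f hf.le))
      gcongr
      exact mul_le_of_le_one_right (norm_nonneg _) (hg ▸ h.norm_apply_le g z)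
    · refine le_max_of_le_right (add_le_add ?_ ?_)
      · calc _ ≤ ‖u‖ * ‖f‖ := by gcongr <;> exact h.norm_apply_le _ _
          _ = ‖u‖ := by rw [hf, mul_one]
      · have := x.le_opNorm f
        rw [hf, mul_one] at this
        gcongr
        exact le_max_of_le_left (hgq z hz hzV)
  · refine max_lt hC ?_
    gcongr
    exact mul_lt_of_lt_one_right hx' (max_lt hq one_pos)

theorem norm_weight_eq_of_isDaugavetCenter (h : IsDiskAlgebra ev) {u φ : X} {G : X →L[ℂ] X}
    (hG : IsWeightedComp ev u φ G) (hD : IsDaugavetCenter G) {w : ℂ}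
    (hw : w ∈ sphere (0 : ℂ) 1) : ‖ev u w‖ = ‖u‖ := by
  refine (h.norm_apply_le u w).eq_of_not_lt fun hlt => ?_
  obtain ⟨r, hr, hru⟩ := exists_between hlt
  obtain ⟨V, hV, hVu⟩ := mem_nhdsWithin_iff_exists_mem_nhds_inter.1
    ((h.continuousWithinAt_sphere u hw).norm.eventually_lt_const hr)
  have hx : h.eval 0 ≠ 0 := by
    intro h0
    obtain ⟨e, -, he⟩ := h.exists_eqOn_one
    have := h.eval_apply 0 e
    rw [h0, he 0 (mem_closedBall_self zero_le_one)] at this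
    simp at this
  refine h.not_isDaugavetCenter_of_functional hG hw hx hV (C := r + ‖h.eval 0‖) (by gcongr) ?_ hD
  intro z hz hzV f hf
  have h1 : ‖ev u z‖ < r := hVu ⟨hzV, hz⟩
  have h2 := (h.norm_apply_le f (ev φ z)).trans hf
  refine add_le_add ?_ ((h.eval 0).unit_le_opNorm f hf)
  exact (mul_le_of_le_one_right (norm_nonneg _) h2).trans h1.le

/-- A holomorphic function bounded by one whose modulus at the centre of a disk is close to one is
nearly constant on a smaller concentric disk. -/
theorem _root_.norm_sub_le_of_norm_le_one {f : ℂ → ℂ} {c z : ℂ} {R : ℝ}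
    (hf : DifferentiableOn ℂ f (ball c R)) (h1 : ∀ z ∈ ball c R, ‖f z‖ ≤ 1) (hz : z ∈ ball c R) :
    ‖f z - f c‖ ≤ (1 - ‖f c‖) * (2 * ‖z - c‖ / (R - ‖z - c‖)) := by
  have hz' : ‖z - c‖ < R := by rwa [mem_ball, dist_eq_norm] at hz
  have hR : 0 < R := (norm_nonneg _).trans_lt hz'
  -- rotate so that the value at the centre is a nonnegative real
  obtain ⟨a, ha, hac⟩ : ∃ a : ℂ, ‖a‖ = 1 ∧ a * f c = ‖f c‖ := by
    by_cases h0 : f c = 0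
    · exact ⟨1, by simp [h0]⟩
    · have : (‖f c‖ : ℂ) ≠ 0 := by simpa using h0
      exact ⟨‖f c‖ / f c, by simp [h0], by field_simp⟩
  have hshift : ∀ ζ ∈ ball (0 : ℂ) R, c + ζ ∈ ball c R := fun ζ hζ => by
    simpa [mem_ball, dist_eq_norm] using hζ
  have key : ∀ M > 1 - ‖f c‖, ‖f z - f c‖ ≤ M * (2 * ‖z - c‖ / (R - ‖z - c‖)) := by
    intro M hM
    have hM0 : 0 < M := by linarith [h1 c (mem_ball_self hR)]
    have := Complex.borelCaratheodory_zero (f := fun ζ => a * (f (c + ζ) - f c)) (z := z - c) hM0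
      (((hf.comp (by fun_prop) hshift).sub_const _).const_mul a) (fun ζ hζ => ?_) hR
      (by simpa using hz') (by simp)
    · simp only [add_sub_cancel, norm_mul, ha, one_mul] at this
      exact this.trans_eq (by ring)
    · have h2 : ‖a * f (c + ζ)‖ ≤ 1 := by
        rw [norm_mul, ha, one_mul]
        exact h1 _ (hshift ζ hζ)
      have h3 := Complex.re_le_norm (a * f (c + ζ))
      change (a * (f (c + ζ) - f c)).re ≤ M
      rw [mul_sub, hac, Complex.sub_re, Complex.ofReal_re]
      linarith
  -- the Borel–Carathéodory inequality needs a strict bound on the real part; pass to the limit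
  refine ge_of_tendsto (x := 𝓝[>] (1 - ‖f c‖)) (f := fun M => M * (2 * ‖z - c‖ / (R - ‖z - c‖)))
    ?_ (eventually_mem_nhdsWithin.mono key)
  exact ((continuous_id.mul continuous_const).tendsto _).mono_left nhdsWithin_le_nhds

/-- A boundary point `w` sent into the open disk is excluded by the functional `f ↦ f(b) - f(a)`
with `a = φ(w)` and `b` close to `a`: it is small on functions whose modulus near `a` is almost
one. -/
theorem norm_symbol_eq_one_of_isDaugavetCenter (h : IsDiskAlgebra ev) {u φ : X} {G : X →L[ℂ] X}
    (hG : IsWeightedComp ev u φ G) (hu : u ≠ 0) (hD : IsDaugavetCenter G) {w : ℂ}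
    (hw : w ∈ sphere (0 : ℂ) 1) : ‖ev φ w‖ = 1 := by
  have hle : ‖ev φ w‖ ≤ 1 := by
    simpa using h.mapsTo_closedBall hG.mapsTo (sphere_subset_closedBall hw)
  refine hle.eq_of_not_lt fun hlt => ?_
  set a := ev φ w
  obtain ⟨r, hr, hra⟩ : ∃ r : ℝ, 0 < r ∧ ‖a‖ + 4 * r < 1 :=
    ⟨(1 - ‖a‖) / 8, by linarith, by linarith⟩
  set b : ℂ := a + r with hb
  have hba : ‖b - a‖ = r := by simp [hb, hr.le]
  have hball : ∀ c ∈ ball a r, ball c (3 * r) ⊆ ball 0 1 := by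
    intro c hc ζ hζ
    rw [mem_ball, dist_eq_norm] at hc hζ
    rw [mem_ball_zero_iff]
    have : ζ = (ζ - c) + (c - a) + a := by ring
    rw [this]
    linarith [norm_add₃_le (a := ζ - c) (b := c - a) (c := a)]
  set x : X →L[ℂ] ℂ := h.eval b - h.eval a
  have hxf : ∀ f : X, x f = ev f b - ev f a := fun f => rfl
  have hx : x ≠ 0 := by
    intro h0
    obtain ⟨f, hf⟩ := h.exists_eqOn_id
    have hbm : b ∈ ball (0 : ℂ) 1 := hball a (mem_ball_self hr) (by
      rw [mem_ball, dist_eq_norm, hba]; linarith)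
    have := hxf f
    rw [h0, hf b (ball_subset_closedBall hbm), hf a (by simpa using hle)] at this
    rw [← this] at hba
    simp at hba
    exact hr.ne hba
  have hxpos : 0 < ‖x‖ := norm_pos_iff.2 hx
  have hupos : 0 < ‖u‖ := norm_pos_iff.2 hu
  -- `a` and `b` are within `2 * r` of `c`, while `f` is bounded by one on `ball c (3 * r)`
  have hbound : ∀ c ∈ ball a r, ∀ f : X, ‖f‖ ≤ 1 → ‖x f‖ ≤ 8 * (1 - ‖ev f c‖) := by
    intro c hc f hf
    have hcr : ‖c - a‖ < r := by rwa [mem_ball, dist_eq_norm] at hc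
    have hfc : 0 ≤ 1 - ‖ev f c‖ := by linarith [h.norm_apply_le f c]
    have hstep : ∀ z, ‖z - c‖ ≤ 2 * r → ‖ev f z - ev f c‖ ≤ 4 * (1 - ‖ev f c‖) := by
      intro z hz
      refine (norm_sub_le_of_norm_le_one (R := 3 * r) ((h.differentiableOn f).mono (hball c hc))
        (fun z _ => (h.norm_apply_le f z).trans hf) ?_).trans ?_
      · rw [mem_ball, dist_eq_norm]; linarith
      · rw [mul_comm]
        gcongr
        rw [div_le_iff₀ (by linarith)]
        linarith
    have e : x f = (ev f b - ev f c) - (ev f a - ev f c) := by rw [hxf]; ring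
    rw [e]
    have hbc : ‖b - c‖ ≤ 2 * r := by
      have : b - c = (b - a) - (c - a) := by ring
      rw [this]
      linarith [norm_sub_le (b - a) (c - a)]
    have hac : ‖a - c‖ ≤ 2 * r := by rw [norm_sub_rev]; linarith
    linarith [norm_sub_le (ev f b - ev f c) (ev f a - ev f c), hstep b hbc, hstep a hac]
  obtain ⟨V, hV, hVφ⟩ := mem_nhdsWithin_iff_exists_mem_nhds_inter.1
    ((h.continuousWithinAt_sphere φ hw).eventually_mem (ball_mem_nhds _ hr))
  have hd1 := min_le_left (‖u‖ * (‖x‖ / 16)) (‖x‖ / 2)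
  have hd2 := min_le_right (‖u‖ * (‖x‖ / 16)) (‖x‖ / 2)
  have hd0 : 0 < min (‖u‖ * (‖x‖ / 16)) (‖x‖ / 2) := lt_min (by positivity) (by positivity)
  set d := min (‖u‖ * (‖x‖ / 16)) (‖x‖ / 2)
  refine h.not_isDaugavetCenter_of_functional hG hw hx hV (C := ‖u‖ + ‖x‖ - d) (by linarith) ?_ hD
  intro z hz hzV f hf
  have h1 := hbound _ (hVφ ⟨hzV, hz⟩) f hf
  set t := ‖ev f (ev φ z)‖
  have ht : t ≤ 1 := (h.norm_apply_le f _).trans hf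
  have hut : ‖ev u z‖ * t ≤ ‖u‖ * t := by
    gcongr
    exact h.norm_apply_le u z
  have hxn := x.unit_le_opNorm f hf
  -- if `t` is far from one the first summand drops, otherwise the second one does
  rcases le_total (‖x‖ / 16) (1 - t) with hlt | hlt <;> nlinarith

end IsDiskAlgebra

/-! ### Sufficiency: boundary bumps with values near the unit interval -/

/-- The function `1 - ((1 - z) / 2) ^ α` with small `α > 0`: the power takes values in a thin sector
about the positive reals, vanishes at `1`, and tends to `1` away from that point as `α → 0`. -/
theorem exists_bump_at_one {δ ε : ℝ} (hδ : 0 < δ) (hε : 0 < ε) :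
    ∃ H : ℂ → ℂ, ContinuousOn H (closedBall 0 1) ∧ DifferentiableOn ℂ H (ball 0 1) ∧ H 1 = 1 ∧
      ∀ z ∈ closedBall (0 : ℂ) 1, ‖H z‖ + ‖1 - H z‖ ≤ 1 + ε ∧ (δ ≤ ‖z - 1‖ → ‖H z‖ ≤ ε) := by
  obtain ⟨α, ⟨hα1, hα2⟩, hα0⟩ : ∃ α : ℝ, (α < min (ε / 8) (1 / 2) ∧ 1 - ε / 2 < (δ / 2) ^ α) ∧
      0 < α := by
    have h1 : ∀ᶠ α : ℝ in 𝓝[>] 0, α < min (ε / 8) (1 / 2) :=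
      nhdsWithin_le_nhds (eventually_lt_nhds (by positivity))
    have h2 : ∀ᶠ α : ℝ in 𝓝[>] 0, 1 - ε / 2 < (δ / 2) ^ α := by
      refine nhdsWithin_le_nhds
        ((Real.continuousAt_const_rpow (by positivity : δ / 2 ≠ 0)).eventually_const_lt ?_)
      simp only [Real.rpow_zero]
      linarith
    exact ((h1.and h2).and self_mem_nhdsWithin).exists
  have hα3 := hα1.trans_le (min_le_left _ _)
  have hα4 := hα1.trans_le (min_le_right _ _)
  have hre : ∀ z ∈ closedBall (0 : ℂ) 1, 0 ≤ ((1 - z) / 2).re := by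
    intro z hz
    have := (Complex.re_le_norm z).trans (mem_closedBall_zero_iff.1 hz)
    rw [show (2 : ℂ) = ((2 : ℝ) : ℂ) by norm_num, Complex.div_ofReal_re, Complex.sub_re,
      Complex.one_re]
    linarith
  refine ⟨fun z => 1 - ((1 - z) / 2) ^ (α : ℂ), fun z hz => ?_, fun z hz => ?_, ?_, fun z hz => ?_⟩
  · refine ContinuousAt.continuousWithinAt (continuousAt_const.sub ?_)
    exact ContinuousAt.comp (f := fun z : ℂ => (1 - z) / 2)
      (Complex.continuousAt_cpow_const_of_re_pos (Or.inl (hre z hz)) (by simpa using hα0))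
      (by fun_prop)
  · refine DifferentiableAt.differentiableWithinAt ((differentiableAt_const 1).sub ?_)
    refine DifferentiableAt.cpow_const (by fun_prop) (Or.inl ?_)
    have := (Complex.re_le_norm z).trans_lt (mem_ball_zero_iff.1 hz)
    rw [show (2 : ℂ) = ((2 : ℝ) : ℂ) by norm_num, Complex.div_ofReal_re, Complex.sub_re,
      Complex.one_re]
    linarith
  · simp [hα0.ne']
  · set q := (1 - z) / 2 with hq
    set t := q.arg * α with ht
    have hq1 : ‖q‖ ≤ 1 := by
      rw [hq, norm_div, Complex.norm_ofNat, div_le_one two_pos]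
      have := norm_sub_le 1 z
      rw [norm_one] at this
      linarith [mem_closedBall_zero_iff.1 hz]
    have hρ0 : 0 ≤ ‖q‖ ^ α := Real.rpow_nonneg (norm_nonneg q) α
    have hρ1 : ‖q‖ ^ α ≤ 1 := Real.rpow_le_one (norm_nonneg q) hq1 hα0.le
    have ht1 : |t| ≤ 2 * α := by
      rw [ht, abs_mul, abs_of_pos hα0]
      gcongr
      exact (Complex.abs_arg_le_pi_div_two_iff.2 (hre z hz)).trans (by linarith [Real.pi_le_four])
    have hcos := Real.one_sub_sq_div_two_le_cos (x := t)
    have htt : t ^ 2 ≤ |t| := by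
      rw [← sq_abs]
      nlinarith [abs_nonneg t]
    have hv : q ^ (α : ℂ) = ((‖q‖ ^ α * Real.cos t : ℝ) : ℂ) +
        ((‖q‖ ^ α * Real.sin t : ℝ) : ℂ) * Complex.I := by
      rw [Complex.cpow_ofReal, ← ht]
      push_cast
      ring
    have hv1 : ‖q ^ (α : ℂ)‖ = ‖q‖ ^ α := Complex.norm_cpow_real q α
    have hv2 : ‖1 - q ^ (α : ℂ)‖ ≤ 1 - ‖q‖ ^ α + 4 * α := by
      refine (Complex.norm_le_abs_re_add_abs_im _).trans ?_
      rw [hv]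
      simp only [Complex.sub_re, Complex.sub_im, Complex.add_re, Complex.add_im, Complex.one_re,
        Complex.one_im, Complex.ofReal_re, Complex.ofReal_im, Complex.re_ofReal_mul,
        Complex.im_ofReal_mul, Complex.I_re, Complex.I_im, mul_zero, mul_one, add_zero, zero_add,
        zero_sub, abs_neg]
      have h1 : |‖q‖ ^ α * Real.sin t| ≤ |t| := by
        rw [abs_mul, abs_of_nonneg hρ0]
        exact (mul_le_of_le_one_left (abs_nonneg _) hρ1).trans Real.abs_sin_le_abs
      rw [abs_of_nonneg (by nlinarith [Real.cos_le_one t])]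
      nlinarith
    rw [sub_sub_cancel, hv1]
    refine ⟨by linarith, fun hz1 => hv2.trans ?_⟩
    have : (δ / 2) ^ α ≤ ‖q‖ ^ α := by
      refine Real.rpow_le_rpow (by positivity) ?_ hα0.le
      rw [hq, norm_div, Complex.norm_ofNat, norm_sub_rev]
      gcongr
    linarith

namespace IsDiskAlgebra

variable {X : Type*} [NormedAddCommGroup X] [NormedSpace ℂ X] {ev : X →ₗ[ℂ] ℂ → ℂ}

/-- `k` takes the value one at the boundary point `w`, is at most `ε` at distance at least `δ` from
`w`, and its values `s` satisfy `‖s‖ + ‖1 - s‖ ≤ 1 + ε`, that is, they are close to the segment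
`[0, 1]`. -/
structure IsBump (ev : X →ₗ[ℂ] ℂ → ℂ) (w : ℂ) (δ ε : ℝ) (k : X) : Prop where
  apply_self : ev k w = 1
  norm_add_le : ∀ z ∈ sphere (0 : ℂ) 1, ‖ev k z‖ + ‖1 - ev k z‖ ≤ 1 + ε
  norm_le : ∀ z ∈ sphere (0 : ℂ) 1, δ ≤ ‖z - w‖ → ‖ev k z‖ ≤ ε

theorem IsBump.mono {w : ℂ} {δ ε δ' ε' : ℝ} {k : X} (hk : IsBump ev w δ ε k) (hδ : δ ≤ δ')
    (hε : ε ≤ ε') : IsBump ev w δ' ε' k :=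
  ⟨hk.apply_self, fun z hz => (hk.norm_add_le z hz).trans (by gcongr),
    fun z hz hzw => (hk.norm_le z hz (hδ.trans hzw)).trans hε⟩

theorem exists_isBump (h : IsDiskAlgebra ev) {w : ℂ} (hw : w ∈ sphere (0 : ℂ) 1) {δ ε : ℝ}
    (hδ : 0 < δ) (hε : 0 < ε) : ∃ k, IsBump ev w δ ε k := by
  obtain ⟨H, hc, hd, h1, hH⟩ := exists_bump_at_one hδ hε
  have hw1 : ‖w‖ = 1 := by simpa using hw
  have hw0 : w ≠ 0 := by
    rintro rfl
    simp at hw1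
  have hm1 : MapsTo (fun z => z / w) (closedBall (0 : ℂ) 1) (closedBall 0 1) := fun z hz => by
    simpa [hw1] using hz
  have hm2 : MapsTo (fun z => z / w) (ball (0 : ℂ) 1) (ball 0 1) := fun z hz => by
    simpa [hw1] using hz
  obtain ⟨k, hk⟩ := h.exists_eqOn (fun z => H (z / w)) (hc.comp (by fun_prop) hm1)
    (hd.comp (by fun_prop) hm2)
  refine ⟨k, ?_, fun z hz => ?_, fun z hz hzw => ?_⟩
  · rw [hk (sphere_subset_closedBall hw)]
    simp [hw0, h1]
  · have hz' := sphere_subset_closedBall hz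
    rw [hk hz']
    exact (hH _ (hm1 hz')).1
  · have hz' := sphere_subset_closedBall hz
    rw [hk hz']
    refine (hH _ (hm1 hz')).2 ?_
    rwa [div_sub_one hw0, norm_div, hw1, div_one]

/-- Bumps at well separated points overlap so little that their unimodular combinations remain
bounded, whatever their number. -/
theorem norm_sum_smul_bump_le (h : IsDiskAlgebra ev) {S : Finset ℂ} {δ ε : ℝ}
    (hS : ∀ p ∈ S.offDiag, 2 * δ ≤ ‖p.1 - p.2‖)
    (hSε : S.card * ε ≤ 1) {k : ℂ → X} (hk : ∀ w ∈ S, IsBump ev w δ ε (k w)) {a : ℂ → ℂ}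
    (ha : ∀ w, ‖a w‖ = 1) : ‖∑ w ∈ S, a w • k w‖ ≤ 3 := by
  refine h.norm_le_of_sphere _ fun z hz => ?_
  rw [map_sum, Finset.sum_apply]
  have hb : ∀ w ∈ S, ‖ev (a w • k w) z‖ ≤ ε + if ‖z - w‖ < δ then 2 else 0 := by
    intro w hw
    rw [map_smul, Pi.smul_apply, norm_smul, ha, one_mul]
    split_ifs with hzw
    · linarith [(hk w hw).norm_add_le z hz, norm_nonneg (1 - ev (k w) z)]
    · simpa using (hk w hw).norm_le z hz (not_lt.1 hzw)
  refine (norm_sum_le_of_le _ hb).trans ?_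
  rw [Finset.sum_add_distrib, Finset.sum_const, nsmul_eq_mul, ← Finset.sum_filter,
    Finset.sum_const, nsmul_eq_mul]
  -- at most one of the points of `S` is within `δ` of `z`
  have hc : (S.filter fun w => ‖z - w‖ < δ).card ≤ 1 := by
    refine Finset.card_le_one.2 fun v hv w hw => ?_
    by_contra hvw
    rw [Finset.mem_filter] at hv hw
    have h1 := hS (v, w) (Finset.mem_offDiag.2 ⟨hv.1, hw.1, hvw⟩)
    have h2 : v - w = (z - w) - (z - v) := by ring
    simp only [h2] at h1
    linarith [norm_sub_le (z - w) (z - v), hv.2, hw.2]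
  have hc' : ((S.filter fun w => ‖z - w‖ < δ).card : ℝ) ≤ 1 := by exact_mod_cast hc
  linarith

/-- On a line norms add up for suitable unimodular coefficients, hence an operator of rank one maps
some member of a large family of almost disjoint bumps to a small vector. -/
theorem exists_isBump_norm_map_le (h : IsDiskAlgebra ev) {T : X →L[ℂ] X} {g : X}
    (hT : ∀ f, ∃ c : ℂ, c • g = T f) {W : Set ℂ} (hW : W.Infinite) (hWs : W ⊆ sphere 0 1)
    {δ ε : ℝ} (hδ : 0 < δ) (hε : 0 < ε) : ∃ w ∈ W, ∃ k, IsBump ev w δ ε k ∧ ‖T k‖ ≤ ε := by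
  obtain ⟨n, hn⟩ := exists_nat_ge (3 * ‖T‖ / ε)
  obtain ⟨S, hSW, hS⟩ := hW.exists_subset_card_eq (n + 1)
  obtain ⟨δ', ⟨hδ1, hδ2⟩, hδ0⟩ : ∃ δ' : ℝ, ((∀ p ∈ S.offDiag, 2 * δ' ≤ ‖p.1 - p.2‖) ∧ δ' ≤ δ) ∧
      0 < δ' := by
    have h1 : ∀ᶠ δ' : ℝ in 𝓝[>] 0, ∀ p ∈ S.offDiag, 2 * δ' ≤ ‖p.1 - p.2‖ := by
      refine (Filter.eventually_all_finset S.offDiag).2 fun p hp => ?_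
      have : 0 < ‖p.1 - p.2‖ := norm_pos_iff.2 (sub_ne_zero.2 (Finset.mem_offDiag.1 hp).2.2)
      filter_upwards [nhdsWithin_le_nhds (eventually_lt_nhds (half_pos this))] with r hr
      linarith
    exact ((h1.and (nhdsWithin_le_nhds (eventually_le_nhds hδ))).and self_mem_nhdsWithin).exists
  have hn0 : (0 : ℝ) < n + 1 := by positivity
  set ε' := min ε (1 / (n + 1 : ℝ))
  have hε0 : 0 < ε' := lt_min hε (by positivity)
  have hε1 : ε' * (n + 1) ≤ 1 := (le_div_iff₀ hn0).1 (min_le_right _ _)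
  choose! k hk using fun w (hw : w ∈ S) => h.exists_isBump (hWs (hSW hw)) hδ0 hε0
  choose c hc using fun w => hT (k w)
  obtain ⟨a, ha, hac⟩ : ∃ a : ℂ → ℂ, (∀ w, ‖a w‖ = 1) ∧ ∀ w, a w * c w = ‖c w‖ := by
    have : ∀ w, ∃ b : ℂ, ‖b‖ = 1 ∧ b * c w = ‖c w‖ := by
      intro w
      by_cases h0 : c w = 0
      · exact ⟨1, by simp [h0]⟩
      · have : (‖c w‖ : ℂ) ≠ 0 := by simpa using h0
        exact ⟨‖c w‖ / c w, by simp [h0], by field_simp⟩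
    choose a ha using this
    exact ⟨a, fun w => (ha w).1, fun w => (ha w).2⟩
  have hsum : ∑ w ∈ S, ‖T (k w)‖ ≤ ‖T‖ * 3 := by
    have h3 := h.norm_sum_smul_bump_le hδ1 (by rw [hS]; push_cast; linarith) hk ha
    refine le_trans (le_of_eq ?_) (T.le_opNorm_of_le h3)
    have e : T (∑ w ∈ S, a w • k w) = ((∑ w ∈ S, ‖c w‖ : ℝ) : ℂ) • g := by
      rw [map_sum, Complex.ofReal_sum, Finset.sum_smul]
      refine Finset.sum_congr rfl fun w _ => ?_
      rw [map_smul, ← hc w, smul_smul, hac]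
    rw [e, norm_smul, Complex.norm_real, Real.norm_of_nonneg (by positivity), Finset.sum_mul]
    refine Finset.sum_congr rfl fun w _ => ?_
    rw [← hc w, norm_smul]
  have hne : S.Nonempty := by
    rw [← Finset.card_pos, hS]
    omega
  obtain ⟨w, hw, hwT⟩ := Finset.exists_le_of_sum_le (f := fun w => ‖T (k w)‖) (g := fun _ => ε) hne
    (by
      rw [Finset.sum_const, hS, nsmul_eq_mul]
      rw [div_le_iff₀ hε] at hn
      push_cast
      linarith)
  exact ⟨w, hSW hw, k w, (hk w hw).mono hδ2 (min_le_left _ _), hwT⟩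

/-- If `φ` took only finitely many values `c` near a boundary point, then a finite product of
rotations of `∏ (φ - c)` would vanish on the circle, hence at the centre; but `φ(0)` lies inside
the disk and every `c` on its boundary. -/
theorem infinite_image_of_norm_eq_one (h : IsDiskAlgebra ev) {φ : X}
    (hφ : MapsTo (ev φ) (ball 0 1) (ball 0 1)) (h1 : ∀ z ∈ sphere (0 : ℂ) 1, ‖ev φ z‖ = 1)
    {w : ℂ} (hw : w ∈ sphere (0 : ℂ) 1) {V : Set ℂ} (hV : V ∈ 𝓝 w) :
    (ev φ '' (V ∩ sphere 0 1)).Infinite := by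
  intro hfin
  have hw1 : ‖w‖ = 1 := by simpa using hw
  -- the rotation by `w / ζ` carries a neighbourhood of `ζ` into `V`
  obtain ⟨A, hA, hAc⟩ := (isCompact_sphere (0 : ℂ) 1).elim_nhds_subcover
    (fun ζ => (fun z => w / ζ * z) ⁻¹' V) (fun ζ hζ => by
      have hζ0 : ζ ≠ 0 := ne_zero_of_mem_unit_sphere ⟨ζ, hζ⟩
      refine ContinuousAt.preimage_mem_nhds (by fun_prop) ?_
      rwa [div_mul_cancel₀ w hζ0])
  have hrot : ∀ ζ ∈ A, ‖w / ζ‖ = 1 := fun ζ hζ => by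
    have : ‖ζ‖ = 1 := by simpa using hA ζ hζ
    rw [norm_div, hw1, this, div_one]
  set F : ℂ → ℂ := fun z => ∏ ζ ∈ A, ∏ c ∈ hfin.toFinset, (ev φ (w / ζ * z) - c) with hF
  have hFd : DiffContOnCl ℂ F (ball 0 1) := by
    have hmaps : ∀ ζ ∈ A, MapsTo (fun z => w / ζ * z) (ball (0 : ℂ) 1) (ball 0 1) :=
      fun ζ hζ z hz => by
        rw [mem_ball_zero_iff, norm_mul, hrot ζ hζ, one_mul]
        simpa using hz
    have hmapsc : ∀ ζ ∈ A, MapsTo (fun z => w / ζ * z) (closedBall (0 : ℂ) 1) (closedBall 0 1) :=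
      fun ζ hζ z hz => by
        rw [mem_closedBall_zero_iff, norm_mul, hrot ζ hζ, one_mul]
        simpa using hz
    refine ⟨?_, ?_⟩
    · refine DifferentiableOn.fun_finsetProd fun ζ hζ => DifferentiableOn.fun_finsetProd
        fun c _ => ?_
      exact ((h.differentiableOn φ).comp (by fun_prop) (hmaps ζ hζ)).sub_const c
    · rw [closure_ball _ one_ne_zero]
      refine continuousOn_finsetProd _ fun ζ hζ => continuousOn_finsetProd _ fun c _ => ?_
      exact ((h.continuousOn φ).comp (by fun_prop) (hmapsc ζ hζ)).sub continuousOn_const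
  have hF0 : ‖F 0‖ ≤ 0 := by
    refine Complex.norm_le_of_forall_mem_frontier_norm_le isBounded_ball hFd ?_
      (subset_closure (mem_ball_self one_pos))
    rw [frontier_ball _ one_ne_zero]
    intro z hz
    obtain ⟨ζ, hζ, hzV⟩ := mem_iUnion₂.1 (hAc hz)
    have hzs : w / ζ * z ∈ sphere (0 : ℂ) 1 := by
      rw [mem_sphere_zero_iff_norm, norm_mul, hrot ζ hζ, one_mul]
      simpa using hz
    have : F z = 0 := Finset.prod_eq_zero hζ (Finset.prod_eq_zero
      (hfin.mem_toFinset.2 ⟨_, ⟨hzV, hzs⟩, rfl⟩) (sub_self _))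
    rw [this, norm_zero]
  rw [norm_le_zero_iff, hF] at hF0
  obtain ⟨ζ, hζ, hF1⟩ := Finset.prod_eq_zero_iff.1 hF0
  obtain ⟨c, hc, hc0⟩ := Finset.prod_eq_zero_iff.1 hF1
  obtain ⟨v, hv, rfl⟩ := hfin.mem_toFinset.1 hc
  have h0 := hφ (mem_ball_self one_pos : (0 : ℂ) ∈ ball 0 1)
  rw [mem_ball_zero_iff] at h0
  rw [mul_zero, sub_eq_zero] at hc0
  rw [hc0, h1 v hv.2] at h0
  exact h0.false

/-- Given `f₀` almost norming `T`, change it by a bump into a function `f` that takes a prescribed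
unimodular value at a point `φ(z)`, where `T f₀` almost attains its norm at `z`. The norm and the
image under `T` are nearly preserved, and the value is chosen to align `G f` with `T f` at `z`. -/
theorem isDaugavetCenter_of_norm_eq (h : IsDiskAlgebra ev) {u φ : X} {G : X →L[ℂ] X}
    (hG : IsWeightedComp ev u φ G) (hφ1 : ∀ z ∈ sphere (0 : ℂ) 1, ‖ev φ z‖ = 1)
    (hu1 : ∀ z ∈ sphere (0 : ℂ) 1, ‖ev u z‖ = ‖u‖) : IsDaugavetCenter G := by
  intro T hT
  obtain ⟨g, -, hg⟩ := finrank_eq_one_iff'.1 hT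
  have hTg : ∀ f, ∃ c : ℂ, c • (g : X) = T f := fun f => by
    obtain ⟨c, hc⟩ := hg ⟨T f, f, rfl⟩
    exact ⟨c, congrArg Subtype.val hc⟩
  refine le_antisymm (norm_add_le G T) ?_
  rw [h.norm_weightedComp hG]
  have key : ∀ ε > 0, ‖u‖ + ‖T‖ - 3 * ε ≤ ‖G + T‖ * (1 + 3 * ε) := by
    intro ε hε
    obtain ⟨f₀, hf₀, hTf₀⟩ := T.exists_lt_apply_of_lt_opNorm (sub_lt_self ‖T‖ hε)
    obtain ⟨z₀, hz₀, hz₀T⟩ := h.exists_mem_sphere_norm_eq (T f₀)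
    obtain ⟨V, hV, hVT⟩ := mem_nhdsWithin_iff_exists_mem_nhds_inter.1
      ((h.continuousWithinAt_sphere (T f₀) hz₀).norm.eventually_const_lt (hz₀T ▸ hTf₀))
    obtain ⟨δ, hδ, hδf⟩ := Metric.uniformContinuousOn_iff.1
      ((isCompact_closedBall (0 : ℂ) 1).uniformContinuousOn_of_continuous (h.continuousOn f₀)) ε hε
    obtain ⟨_, ⟨z, ⟨hzV, hz⟩, rfl⟩, k, hk, hTk⟩ := h.exists_isBump_norm_map_le hTg
      (h.infinite_image_of_norm_eq_one hG.mapsTo hφ1 hz₀ hV)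
      (by rintro _ ⟨z, hz, rfl⟩; simpa using hφ1 z hz.2) hδ hε
    set w := ev φ z with hw
    have hw1 : ‖w‖ = 1 := hφ1 z hz
    have hzT : ‖T‖ - ε < ‖ev (T f₀) z‖ := hVT ⟨hzV, hz⟩
    obtain ⟨l, hl, hlz⟩ : ∃ l : ℂ, ‖l‖ = 1 ∧
        ‖ev u z * l + ev (T f₀) z‖ = ‖ev u z‖ + ‖ev (T f₀) z‖ := by
      obtain ⟨p, hp, hpu⟩ := (⟨_, Complex.norm_exp_ofReal_mul_I _,
        Complex.norm_mul_exp_arg_mul_I (ev u z)⟩ : ∃ p : ℂ, ‖p‖ = 1 ∧ ‖ev u z‖ * p = ev u z)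
      obtain ⟨s, hs, hsT⟩ := (⟨_, Complex.norm_exp_ofReal_mul_I _,
        Complex.norm_mul_exp_arg_mul_I (ev (T f₀) z)⟩ :
          ∃ s : ℂ, ‖s‖ = 1 ∧ ‖ev (T f₀) z‖ * s = ev (T f₀) z)
      have hp0 : p ≠ 0 := by
        rintro rfl
        simp at hp
      refine ⟨s / p, by rw [norm_div, hs, hp, div_one], ?_⟩
      have e : ev u z * (s / p) + ev (T f₀) z = ((‖ev u z‖ + ‖ev (T f₀) z‖ : ℝ) : ℂ) * s := by
        rw [Complex.ofReal_add, add_mul, hsT]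
        nth_rw 1 [← hpu]
        field_simp
      rw [e, norm_mul, hs, mul_one, Complex.norm_real, Real.norm_of_nonneg (by positivity)]
    have hf₀le : ∀ ζ, ‖ev f₀ ζ‖ ≤ 1 := fun ζ => (h.norm_apply_le f₀ ζ).trans hf₀.le
    have hlw : ‖l - ev f₀ w‖ ≤ 2 := by
      linarith [norm_sub_le l (ev f₀ w), hf₀le w]
    set f : X := f₀ + (l - ev f₀ w) • k with hf
    have hfz : ∀ ζ, ev f ζ = ev f₀ ζ + (l - ev f₀ w) * ev k ζ := fun ζ => by simp [hf]
    have hfn : ‖f‖ ≤ 1 + 3 * ε := by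
      refine h.norm_le_of_sphere f fun ζ hζ => ?_
      rw [hfz]
      have hkζ := hk.norm_add_le ζ hζ
      rcases lt_or_ge ‖ζ - w‖ δ with hlt | hge
      · have hd := hδf ζ (sphere_subset_closedBall hζ) w (by simp [hw1])
          (by rwa [dist_eq_norm])
        rw [dist_eq_norm] at hd
        -- near `w` the value is close to a combination of `f₀(w)` and `l` with weights `1 - k`, `k`
        have e : ev f₀ ζ + (l - ev f₀ w) * ev k ζ =
            (ev f₀ ζ - ev f₀ w) + ev f₀ w * (1 - ev k ζ) + l * ev k ζ := by ring
        rw [e]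
        refine norm_add₃_le.trans ?_
        rw [norm_mul, norm_mul, hl, one_mul]
        have := mul_le_of_le_one_left (norm_nonneg (1 - ev k ζ)) (hf₀le w)
        linarith
      · refine (norm_add_le _ _).trans ?_
        rw [norm_mul]
        have := mul_le_mul hlw (hk.norm_le ζ hζ hge) (norm_nonneg _) zero_le_two
        linarith [hf₀le ζ]
    have hval : ev ((G + T) f) z =
        (ev u z * l + ev (T f₀) z) + (l - ev f₀ w) * ev (T k) z := by
      have e1 : ev (G f) z = ev u z * l := by
        rw [hG.apply_eq f z (sphere_subset_closedBall hz), ← hw, hfz, hk.apply_self]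
        ring
      have e2 : ev (T f) z = ev (T f₀) z + (l - ev f₀ w) * ev (T k) z := by simp [hf]
      rw [add_apply, map_add, Pi.add_apply, e1, e2]
      ring
    have hlow : ‖u‖ + ‖T‖ - 3 * ε ≤ ‖ev ((G + T) f) z‖ := by
      rw [hval]
      have h1 := norm_sub_le_norm_add (ev u z * l + ev (T f₀) z) ((l - ev f₀ w) * ev (T k) z)
      have h2 := mul_le_mul hlw ((h.norm_apply_le (T k) z).trans hTk) (norm_nonneg _) zero_le_two
      rw [norm_mul (l - ev f₀ w), hlz, hu1 z hz] at h1
      linarith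
    exact hlow.trans ((h.norm_apply_le _ z).trans ((G + T).le_opNorm_of_le hfn))
  have hl : Tendsto (fun ε : ℝ => ‖u‖ + ‖T‖ - 3 * ε) (𝓝[>] 0) (𝓝 (‖u‖ + ‖T‖)) := by
    refine Tendsto.mono_left ?_ nhdsWithin_le_nhds
    exact Continuous.tendsto' (by fun_prop) _ _ (by simp)
  have hr : Tendsto (fun ε : ℝ => ‖G + T‖ * (1 + 3 * ε)) (𝓝[>] 0) (𝓝 ‖G + T‖) := by
    refine Tendsto.mono_left ?_ nhdsWithin_le_nhds
    exact Continuous.tendsto' (by fun_prop) _ _ (by simp)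
  exact le_of_tendsto_of_tendsto hl hr (eventually_mem_nhdsWithin.mono key)

end IsDiskAlgebra

/-! ### Inner functions that are continuous up to the boundary -/

theorem eventually_mul_exp_mem_ball (θ : ℝ) :
    ∀ᶠ r : ℝ in 𝓝[<] 1, (r * Complex.exp (θ * Complex.I) : ℂ) ∈ ball (0 : ℂ) 1 := by
  filter_upwards [Ioo_mem_nhdsLT (zero_lt_one (α := ℝ))] with r hr
  rw [mem_ball_zero_iff, norm_mul, Complex.norm_exp_ofReal_mul_I, mul_one, Complex.norm_real,
    Real.norm_of_nonneg hr.1.le]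
  exact hr.2

theorem exp_mul_I_mem_sphere (θ : ℝ) : Complex.exp (θ * Complex.I) ∈ sphere (0 : ℂ) 1 := by
  rw [mem_sphere_zero_iff_norm, Complex.norm_exp_ofReal_mul_I]

theorem ContinuousOn.tendsto_radial {F : ℂ → ℂ} (hF : ContinuousOn F (closedBall 0 1)) (θ : ℝ) :
    Tendsto (fun r : ℝ => F (r * Complex.exp (θ * Complex.I))) (𝓝[<] 1)
      (𝓝 (F (Complex.exp (θ * Complex.I)))) := by
  refine (hF _ (sphere_subset_closedBall (exp_mul_I_mem_sphere θ))).tendsto.comp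
    (tendsto_nhdsWithin_iff.2 ⟨Tendsto.mono_left ?_ nhdsWithin_le_nhds,
      (eventually_mul_exp_mem_ball θ).mono fun _ hr => ball_subset_closedBall hr⟩)
  exact Continuous.tendsto' (by fun_prop) _ _ (by simp)

/-- For a function continuous up to the boundary, an almost sure modulus of the radial limits is the
modulus at every boundary point. -/
theorem ContinuousOn.norm_eq_of_ae_radial {F : ℂ → ℂ} (hF : ContinuousOn F (closedBall 0 1)) {C : ℝ}
    (h : ∀ᵐ θ : ℝ, ∃ l : ℂ, ‖l‖ = C ∧
      Tendsto (fun r : ℝ => F (r * Complex.exp (θ * Complex.I))) (𝓝[<] 1) (𝓝 l))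
    {z : ℂ} (hz : z ∈ sphere (0 : ℂ) 1) : ‖F z‖ = C := by
  have hc : Continuous fun θ : ℝ => ‖F (Complex.exp (θ * Complex.I))‖ :=
    (hF.comp_continuous (by fun_prop)
      fun θ => sphere_subset_closedBall (exp_mul_I_mem_sphere θ)).norm
  have hae : (fun θ : ℝ => ‖F (Complex.exp (θ * Complex.I))‖) =ᵐ[MeasureTheory.volume]
      fun _ => C := by
    filter_upwards [h] with θ ⟨l, hl, hlt⟩
    rw [tendsto_nhds_unique (hF.tendsto_radial θ) hlt, hl]
  have := congrFun ((hc.ae_eq_iff_eq MeasureTheory.volume continuous_const).1 hae) z.arg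
  rw [mem_sphere_zero_iff_norm] at hz
  have hza : Complex.exp (z.arg * Complex.I) = z := by
    simpa [hz] using Complex.norm_mul_exp_arg_mul_I z
  simpa only [hza] using this

theorem IsInnerFunction.of_norm_eq_one {F : ℂ → ℂ} (hF : ContinuousOn F (closedBall 0 1))
    (hd : DifferentiableOn ℂ F (ball 0 1)) (h1 : ∀ z ∈ sphere (0 : ℂ) 1, ‖F z‖ = 1) :
    IsInnerFunction F where
  differentiableOn := hd
  norm_le_one z hz := by
    refine Complex.norm_le_of_forall_mem_frontier_norm_le isBounded_ball
      ⟨hd, by rwa [closure_ball _ one_ne_zero]⟩ (fun w hw => ?_) (subset_closure hz)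
    rw [frontier_ball _ one_ne_zero] at hw
    exact (h1 w hw).le
  radial_limit := Eventually.of_forall fun θ =>
    ⟨_, h1 _ (exp_mul_I_mem_sphere θ), hF.tendsto_radial θ⟩

namespace IsDiskAlgebra

variable {X : Type*} [NormedAddCommGroup X] [NormedSpace ℂ X] {ev : X →ₗ[ℂ] ℂ → ℂ}

theorem isDaugavetCenter_iff (h : IsDiskAlgebra ev) {u φ : X} {G : X →L[ℂ] X}
    (hG : IsWeightedComp ev u φ G) (hu : u ≠ 0) :
    IsDaugavetCenter G ↔ IsInnerFunction (ev φ) ∧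
      ∃ (c : ℂ) (v : ℂ → ℂ), IsInnerFunction v ∧ ∀ z ∈ ball (0 : ℂ) 1, ev u z = c * v z := by
  constructor
  · intro hD
    have hn : (‖u‖ : ℂ) ≠ 0 := by simpa using hu
    refine ⟨.of_norm_eq_one (h.continuousOn φ) (h.differentiableOn φ) fun z hz =>
      h.norm_symbol_eq_one_of_isDaugavetCenter hG hu hD hz, ‖u‖, fun z => ev u z / ‖u‖,
      .of_norm_eq_one ((h.continuousOn u).div_const _) ((h.differentiableOn u).div_const _)
      fun z hz => ?_, fun z _ => by field_simp⟩
    rw [norm_div, h.norm_weight_eq_of_isDaugavetCenter hG hD hz, Complex.norm_real, norm_norm,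
      div_self (norm_ne_zero_iff.2 hu)]
  · rintro ⟨hφ, c, v, hv, huv⟩
    have hc : ∀ z ∈ sphere (0 : ℂ) 1, ‖ev u z‖ = ‖c‖ := fun z hz => by
      refine (h.continuousOn u).norm_eq_of_ae_radial ?_ hz
      filter_upwards [hv.radial_limit] with θ ⟨l, hl, hlt⟩
      refine ⟨c * l, by rw [norm_mul, hl, mul_one], (hlt.const_mul c).congr' ?_⟩
      exact (eventually_mul_exp_mem_ball θ).mono fun r hr => (huv _ hr).symm
    refine h.isDaugavetCenter_of_norm_eq hG
      (fun z hz => (h.continuousOn φ).norm_eq_of_ae_radial hφ.radial_limit hz) fun z hz => ?_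
    rw [hc z hz, h.norm_eq_of_sphere u hc]

end IsDiskAlgebra

/-! ### The disk algebra as an instance -/

namespace DiskAlgebra

theorem toFun_of_notMem (f : DiskAlgebra) {z : ℂ} (hz : z ∉ closedBall (0 : ℂ) 1) :
    f.toFun z = 0 := by
  refine Function.extend_apply' _ _ _ ?_
  rintro ⟨w, rfl⟩
  exact hz w.2

/-- The passage from elements of `DiskAlgebra` to functions on `ℂ`, as a linear map. -/
noncomputable def toFunLinear : DiskAlgebra →ₗ[ℂ] ℂ → ℂ where
  toFun := toFun
  map_add' f g := by
    funext z
    change (f + g).toFun z = f.toFun z + g.toFun z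
    by_cases hz : z ∈ closedBall (0 : ℂ) 1
    · rw [toFun_apply _ hz, toFun_apply _ hz, toFun_apply _ hz]
      rfl
    · rw [toFun_of_notMem _ hz, toFun_of_notMem _ hz, toFun_of_notMem _ hz, add_zero]
  map_smul' c f := by
    funext z
    change (c • f).toFun z = c * f.toFun z
    by_cases hz : z ∈ closedBall (0 : ℂ) 1
    · rw [toFun_apply _ hz, toFun_apply _ hz]
      rfl
    · rw [toFun_of_notMem _ hz, toFun_of_notMem _ hz, mul_zero]

theorem isDiskAlgebra_toFunLinear : IsDiskAlgebra toFunLinear where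
  eq_zero f _ hz := f.toFun_of_notMem hz
  continuousOn := continuousOn_toFun
  differentiableOn := differentiableOn_toFun
  isLUB_norm := isLUB_norm
  exists_eqOn F hc hd :=
    ⟨⟨⟨(closedBall (0 : ℂ) 1).domRestrict F, continuousOn_iff_continuous_domRestrict.1 hc⟩,
      hd.congr fun _ hz => closedDiskExtend_apply _ (ball_subset_closedBall hz)⟩,
      fun _ hz => toFun_apply _ hz⟩

end DiskAlgebra

theorem mainTheorem2 (φ u : DiskAlgebra)
    (hφ : MapsTo φ.toFun (ball 0 1) (ball 0 1)) (hu : u ≠ 0) :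
    IsDaugavetCenter (DiskAlgebra.weightedCompOp u φ hφ) ↔
      IsInnerFunction φ.toFun ∧
        ∃ (c : ℂ) (v : ℂ → ℂ), IsInnerFunction v ∧
          ∀ z ∈ ball (0 : ℂ) 1, u.toFun z = c * v z :=
  DiskAlgebra.isDiskAlgebra_toFunLinear.isDaugavetCenter_iff
    ⟨hφ, fun f _ hz => DiskAlgebra.weightedCompOp_toFun u φ hφ f hz⟩ hu
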